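/- A ribbon graph $\mathbb{G}=(V,E)$ is a surface with boundary, given as the union of finitely many vertex discs and edge discs, where vertices and edges meet in disjoint line segments, each such segment lies on the boundary of exactly one vertex and exactly one edge, and each edge contains exactly two of them. A coloured ribbon graph is a ribbon graph together with a colouring $\mathcal V$ of its vertices and a colouring $\mathcal B$ of its boundary components. Its dual $\mathbb{G}^*$ has the same edge discs; its vertices are discs glued to the boundary components of $\mathbb{G}$, and the original vertex discs are removed. The vertices of $\mathbb{G}^*$ inherit the colours of the boundary components of $\mathbb{G}$, and the boundary components of $\mathbb{G}^*$ inherit the colours of the vertices of $\mathbb{G}$. For a set of edges $A$, $\mathbb{G}\backslash A$ and $\mathbb{G}/A$ denote ribbon graph deletion and contraction (contraction removes the edges in $A$ and their vertices and glues a new vertex disc to every boundary component of the ribbon subgraph that they form); $A^c=E\setminus A$ and $e^c=E\setminus\{e\}$. Deletion keeps the vertex colours and, for each deleted edge, merges the colour classes of the boundary components along its two sides; contraction keeps the boundary colours and, for each contracted edge, merges the colour classes of the vertices at its two ends. New boundary components (respectively, vertices) take the merged colour of the old ones they arise from. Let $\mathbb{G}/\mathcal V$ be the graph whose vertices are the vertex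 colour classes, each edge of $\mathbb{G}$ joining the classes of its two end vertices, and let $\mathbb{G}^*/\mathcal B$ be the graph whose vertices are the boundary colour classes, each edge of $\mathbb{G}$ joining the classes of the boundary components along its two sides. For a graph $H$, $r_H(A)$ is the number of vertices of $H$ minus the number of components of its spanning subgraph with edge set $A$. Let $\rho(\mathbb{G})=r(\mathbb{G})+\tfrac12\gamma(\mathbb{G})$, where $r(\mathbb{G})$ is the rank of the underlying graph and $\gamma(\mathbb{G})=2k(\mathbb{G})-|V|+|E|-b(\mathbb{G})$ is the Euler genus ($k$ the number of components, $b$ the number of boundary components), and let $\rho(A)=\rho(\mathbb{G}\backslash A^c)$. For $A\subseteq E$ put $$r_1(A)=r_{\mathbb{G}/\mathcal V}(A),\qquad r_2(A)=\rho(A)-r_{\mathbb{G}/\mathcal V}(A),$$ $$r_3(A)=r_{\mathbb{G}^*/\mathcal B}(E)-r_{\mathbb{G}^*/\mathcal B}(A^c),\qquad r_4(A)=|A|+r_{\mathbb{G}^*/\mathcal B}(A^c)-r_{\mathbb{G}^*/\mathcal B}(E)-\rho(A),$$ and define $$T_{ps}(\mathbb{G};w,x,y,z)=\sum_{A\subseteq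 E}w^{r_1(E)-r_1(A)}\,x^{r_2(E)-r_2(A)}\,y^{r_3(A)}\,z^{r_4(A)},$$ a polynomial expression with integer coefficients and rational exponents in the indeterminates $w,x,y,z$. The five connected coloured ribbon graphs with one edge are $\mathrm{bs}$ (two vertices joined by an edge, of different colours), $\mathrm{bp}$ (the same with both vertices of one colour), $\mathrm{olc}$ (one vertex with an orientable loop, the two boundary components of different colours), $\mathrm{olh}$ (the same with both boundary components of one colour), and $\mathrm{nl}$ (one vertex with a non-orientable loop). An edge $e$ of $\mathbb{G}$ is of type $(i,j)$, with $i,j\in\{\mathrm{bs},\mathrm{bp},\mathrm{olc},\mathrm{olh},\mathrm{nl}\}$, if after isolated vertices are discarded $\mathbb{G}/e^c$ is $i$ and $\mathbb{G}\backslash e^c$ is $j$. Let $i\mapsto i^*$ be the exchange $\mathrm{bs}\leftrightarrow\mathrm{olc}$, $\mathrm{bp}\leftrightarrow\mathrm{olh}$, with $\mathrm{nl}^*=\mathrm{nl}$. **Theorem (Duality).** For every coloured ribbon graph $\mathbb{G}$, $$T_{ps}(\mathbb{G}^*;w,x,y,z)=T_{ps}(\mathbb{G};y,z,w,x).$$ Moreover,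 for every edge $e$ and all $i,j$, the edge $e$ is of type $(i,j)$ in $\mathbb{G}$ if and only if it is of type $(j^*,i^*)$ in $\mathbb{G}^*$. -/

import Mathlib

/-! ### Return maps

`skip t s S` follows the path `c, t c, s (t c), t (s (t c)), …`, in which the steps `s` are taken at
points outside `S`, and stops at the first point of `S` that it meets after the initial step. -/

section ReturnMap

variable {C : Type*}

open Classical in
/-- One step of the path: cross `s` when outside `S`, then apply `t`. -/
noncomputable def skipStep (t s : C → C) (S : Set C) (c : C) : C :=
  t (if c ∈ S then c else s c)

open Classical in
/-- Crossing `s` when outside `S`. -/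
noncomputable def skipCross (s : C → C) (S : Set C) (c : C) : C :=
  if c ∈ S then c else s c

theorem skipStep_eq (t s : C → C) (S : Set C) (c : C) :
    skipStep t s S c = t (skipCross s S c) := rfl

theorem skipCross_of_mem {s : C → C} {S : Set C} {c : C} (h : c ∈ S) : skipCross s S c = c :=
  if_pos h

theorem skipCross_of_notMem {s : C → C} {S : Set C} {c : C} (h : c ∉ S) :
    skipCross s S c = s c := if_neg h

theorem skipCross_mem {s : C → C} {S : Set C} (hS : ∀ c, s c ∈ S ↔ c ∈ S) (c : C) :
    skipCross s S c ∈ S ↔ c ∈ S := by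
  by_cases h : c ∈ S
  · rw [skipCross_of_mem h]
  · rw [skipCross_of_notMem h, hS]

theorem skipCross_invol {s : C → C} {S : Set C} (hs : Function.Involutive s)
    (hS : ∀ c, s c ∈ S ↔ c ∈ S) : Function.Involutive (skipCross s S) := by
  intro c
  by_cases h : c ∈ S
  · rw [skipCross_of_mem h, skipCross_of_mem h]
  · rw [skipCross_of_notMem h, skipCross_of_notMem (fun h' => h ((hS c).1 h')), hs]

theorem skipStep_injective {t s : C → C} {S : Set C} (ht : Function.Involutive t)
    (hs : Function.Involutive s) (hS : ∀ c, s c ∈ S ↔ c ∈ S) :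
    Function.Injective (skipStep t s S) := by
  intro c d h
  rw [skipStep_eq, skipStep_eq] at h
  exact (skipCross_invol hs hS).injective (ht.injective h)

theorem exists_return [Finite C] {t s : C → C} {S : Set C} (ht : Function.Involutive t)
    (hs : Function.Involutive s) (hS : ∀ c, s c ∈ S ↔ c ∈ S) {c : C} (hc : c ∈ S) :
    ∃ n : ℕ, (skipStep t s S)^[n + 1] c ∈ S := by
  obtain ⟨m, hm, hp⟩ := Function.mem_periodicPts.1
    ((skipStep_injective ht hs hS).mem_periodicPts c)
  refine ⟨m - 1, ?_⟩
  rw [Nat.sub_add_cancel hm, hp.eq]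
  exact hc

open Classical in
/-- The first point of `S` on the path after `c`; if there is none, the value is the junk `c`. -/
noncomputable def skip (t s : C → C) (S : Set C) (c : C) : C :=
  if h : ∃ n : ℕ, (skipStep t s S)^[n + 1] c ∈ S then
    (skipStep t s S)^[Nat.find h + 1] c else c

/-- The defining property of the first return. -/
theorem skip_spec {t s : C → C} {S : Set C} {c : C}
    (h : ∃ n : ℕ, (skipStep t s S)^[n + 1] c ∈ S) :
    ∃ n : ℕ, skip t s S c = (skipStep t s S)^[n + 1] c ∧
      (skipStep t s S)^[n + 1] c ∈ S ∧ ∀ k < n, (skipStep t s S)^[k + 1] c ∉ S := by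
  classical
  refine ⟨Nat.find h, ?_, Nat.find_spec h, fun k hk => Nat.find_min h hk⟩
  rw [skip, dif_pos h]

theorem skip_eq {t s : C → C} {S : Set C} {c : C} {n : ℕ}
    (h1 : (skipStep t s S)^[n + 1] c ∈ S) (h2 : ∀ k < n, (skipStep t s S)^[k + 1] c ∉ S) :
    skip t s S c = (skipStep t s S)^[n + 1] c := by
  obtain ⟨m, hm, hm1, hm2⟩ := skip_spec ⟨n, h1⟩
  have : m = n := by
    rcases lt_trichotomy m n with h | h | h
    · exact absurd hm1 (h2 m h)
    · exact h
    · exact absurd h1 (hm2 n h)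
  rw [hm, this]

theorem skip_mem [Finite C] {t s : C → C} {S : Set C} (ht : Function.Involutive t)
    (hs : Function.Involutive s) (hS : ∀ c, s c ∈ S ↔ c ∈ S) {c : C} (hc : c ∈ S) :
    skip t s S c ∈ S := by
  obtain ⟨n, h, h1, -⟩ := skip_spec (exists_return (t := t) ht hs hS hc)
  rw [h]; exact h1

/-- The path can be walked backwards. -/
theorem skip_reverse {t s : C → C} {S : Set C} (ht : Function.Involutive t)
    (hs : Function.Involutive s) (hS : ∀ c, s c ∈ S ↔ c ∈ S) (n k : ℕ) (hk : k ≤ n) (c : C) :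
    (skipStep t s S)^[k] (skipCross s S ((skipStep t s S)^[n] c)) =
      skipCross s S ((skipStep t s S)^[n - k] c) := by
  induction k with
  | zero => rfl
  | succ k ih =>
    have hlt : n - k = (n - (k + 1)) + 1 := by omega
    rw [Function.iterate_succ_apply', ih (by omega), skipStep_eq, skipCross_invol hs hS, hlt,
      Function.iterate_succ_apply', skipStep_eq, ht]

theorem skip_invol [Finite C] {t s : C → C} {S : Set C} (ht : Function.Involutive t)
    (hs : Function.Involutive s) (hS : ∀ c, s c ∈ S ↔ c ∈ S) {c : C} (hc : c ∈ S) :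
    skip t s S (skip t s S c) = c := by
  obtain ⟨n, h, h1, h2⟩ := skip_spec (exists_return (t := t) ht hs hS hc)
  have hrev := fun k hk => skip_reverse (t := t) ht hs hS (n + 1) k hk c
  rw [skipCross_of_mem h1] at hrev
  have hend : (skipStep t s S)^[n + 1] ((skipStep t s S)^[n + 1] c) = c := by
    rw [hrev (n + 1) le_rfl, Nat.sub_self]
    exact skipCross_of_mem hc
  rw [h, skip_eq (n := n) (by rw [hend]; exact hc), hend]
  intro k hk
  rw [hrev (k + 1) (by omega), skipCross_mem hS]
  have : n + 1 - (k + 1) = (n - k - 1) + 1 := by omega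
  rw [this]
  exact h2 _ (by omega)

theorem skip_ne [Finite C] {t s : C → C} {S : Set C} (ht : Function.Involutive t)
    (ht' : ∀ c, t c ≠ c) (hs : Function.Involutive s) (hs' : ∀ c, s c ≠ c)
    (hS : ∀ c, s c ∈ S ↔ c ∈ S) {c : C} (hc : c ∈ S) : skip t s S c ≠ c := by
  obtain ⟨n, h, h1, h2⟩ := skip_spec (exists_return (t := t) ht hs hS hc)
  intro heq
  rw [h] at heq
  have hrev := fun k hk => skip_reverse (t := t) ht hs hS (n + 1) k hk c
  rw [heq, skipCross_of_mem hc] at hrev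
  rcases Nat.even_or_odd' n with ⟨m, hm | hm⟩
  · have h3 := hrev (m + 1) (by omega)
    have h4 : n + 1 - (m + 1) = m := by omega
    rw [h4, Function.iterate_succ_apply', skipStep_eq] at h3
    exact ht' _ h3
  · have h3 := hrev (m + 1) (by omega)
    have h4 : n + 1 - (m + 1) = m + 1 := by omega
    rw [h4, skipCross_of_notMem (h2 m (by omega))] at h3
    exact hs' _ h3.symm

/-- A function that does not change along the steps of the path agrees at its two ends. -/
theorem skip_invariant {X : Type*} {t s : C → C} {S : Set C} (g : C → X)
    (h1 : ∀ c, g (t c) = g c) (h2 : ∀ c, c ∉ S → g (s c) = g c) (c : C) :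
    g (skip t s S c) = g c := by
  have key : ∀ n : ℕ, g ((skipStep t s S)^[n] c) = g c := by
    intro n
    induction n with
    | zero => rfl
    | succ n ih =>
      rw [Function.iterate_succ_apply', skipStep_eq, h1, ← ih]
      by_cases hS : (skipStep t s S)^[n] c ∈ S
      · rw [skipCross_of_mem hS]
      · rw [skipCross_of_notMem hS, h2 _ hS]
  rw [skip]
  split_ifs
  · exact key _
  · rfl

end ReturnMap

/-! ### Ribbon graphs -/

universe u

/-- A (finite) ribbon graph, presented combinatorially.

Each edge is a disc whose boundary circle consists of its two attaching segments (where it meets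
vertex discs) and its two free sides. The *corners* are the four endpoints of the attaching segments
of each edge. For a corner `c`,
* `t2 c` is the other endpoint of the attaching segment at `c`,
* `t0 c` is the other endpoint of the free side of the edge at `c`,
* `t1 c` is the other endpoint of the arc of the vertex boundary that starts at `c` and runs, away
  from the attaching segment at `c`, up to the next attaching segment.
The boundary circle of a vertex disc with at least one attaching segment is an orbit of `t1, t2`.
Vertices without attaching segments have no corners and are listed separately in `Isolated`. -/
structure RibbonGraph where
  /-- The corners. -/
  Corner : Type u
  /-- The edges. -/
  Edge : Type u
  /-- The isolated vertices. -/
  Isolated : Type u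
  [finCorner : Finite Corner]
  [finEdge : Finite Edge]
  [finIsolated : Finite Isolated]
  /-- The edge to which a corner belongs. -/
  edge : Corner → Edge
  /-- Along a free side of the edge. -/
  t0 : Corner → Corner
  /-- Along an arc of the vertex boundary. -/
  t1 : Corner → Corner
  /-- Along an attaching segment. -/
  t2 : Corner → Corner
  t0_invol : ∀ c, t0 (t0 c) = c
  t1_invol : ∀ c, t1 (t1 c) = c
  t2_invol : ∀ c, t2 (t2 c) = c
  t0_ne : ∀ c, t0 c ≠ c
  t1_ne : ∀ c, t1 c ≠ c
  t2_ne : ∀ c, t2 c ≠ c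
  t0_ne_t2 : ∀ c, t0 c ≠ t2 c
  t0_t2 : ∀ c, t0 (t2 c) = t2 (t0 c)
  edge_surj : ∀ e, ∃ c, edge c = e
  edge_eq_iff : ∀ c d, edge d = edge c ↔ d = c ∨ d = t0 c ∨ d = t2 c ∨ d = t0 (t2 c)

attribute [instance] RibbonGraph.finCorner RibbonGraph.finEdge RibbonGraph.finIsolated

namespace RibbonGraph

variable (G : RibbonGraph.{u})

theorem edge_t0 (c : G.Corner) : G.edge (G.t0 c) = G.edge c :=
  (G.edge_eq_iff c _).2 (Or.inr (Or.inl rfl))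

theorem edge_t2 (c : G.Corner) : G.edge (G.t2 c) = G.edge c :=
  (G.edge_eq_iff c _).2 (Or.inr (Or.inr (Or.inl rfl)))

/-- The boundary circles of the non-isolated vertices. -/
def VertexOrbit : Type u := Quot fun c d : G.Corner => d = G.t1 c ∨ d = G.t2 c

/-- The boundary components of the surface that meet at least one edge. -/
def BoundaryOrbit : Type u := Quot fun c d : G.Corner => d = G.t1 c ∨ d = G.t0 c

/-- The set of vertices. -/
abbrev Vertex : Type u := G.VertexOrbit ⊕ G.Isolated

/-- The set of boundary components; an isolated vertex is a disc and has its own one. -/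
abbrev Boundary : Type u := G.BoundaryOrbit ⊕ G.Isolated

/-- The vertex on whose boundary a corner lies. -/
def vert (c : G.Corner) : G.Vertex := Sum.inl (Quot.mk _ c)

/-- The boundary component on which a corner lies. -/
def bdry (c : G.Corner) : G.Boundary := Sum.inl (Quot.mk _ c)

theorem vert_t1 (c : G.Corner) : G.vert (G.t1 c) = G.vert c :=
  congrArg Sum.inl (Quot.sound (a := c) (Or.inl rfl)).symm

theorem vert_t2 (c : G.Corner) : G.vert (G.t2 c) = G.vert c :=
  congrArg Sum.inl (Quot.sound (a := c) (Or.inr rfl)).symm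

theorem bdry_t1 (c : G.Corner) : G.bdry (G.t1 c) = G.bdry c :=
  congrArg Sum.inl (Quot.sound (a := c) (Or.inl rfl)).symm

theorem bdry_t0 (c : G.Corner) : G.bdry (G.t0 c) = G.bdry c :=
  congrArg Sum.inl (Quot.sound (a := c) (Or.inr rfl)).symm

/-- The geometric dual: the vertex discs are removed and a disc is glued to every boundary
component. The edge discs stay, and their free sides and attaching segments trade places. -/
@[reducible]
def dual : RibbonGraph.{u} where
  Corner := G.Corner
  Edge := G.Edge
  Isolated := G.Isolated
  edge := G.edge
  t0 := G.t2
  t1 := G.t1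
  t2 := G.t0
  t0_invol := G.t2_invol
  t1_invol := G.t1_invol
  t2_invol := G.t0_invol
  t0_ne := G.t2_ne
  t1_ne := G.t1_ne
  t2_ne := G.t0_ne
  t0_ne_t2 c := (G.t0_ne_t2 c).symm
  t0_t2 c := (G.t0_t2 c).symm
  edge_surj := G.edge_surj
  edge_eq_iff c d := by rw [G.edge_eq_iff, G.t0_t2]; tauto

/-- The corners of the edges outside `D`. -/
def keep (D : Set G.Edge) : Set G.Corner := {c | G.edge c ∉ D}

theorem keep_t0 (D : Set G.Edge) (c : G.Corner) : G.t0 c ∈ G.keep D ↔ c ∈ G.keep D := by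
  simp only [keep, Set.mem_ofPred_eq, edge_t0]

theorem keep_t2 (D : Set G.Edge) (c : G.Corner) : G.t2 c ∈ G.keep D ↔ c ∈ G.keep D := by
  simp only [keep, Set.mem_ofPred_eq, edge_t2]

/-- The corners on vertices all of whose incident edges lie in `D`. -/
def StrippedVertexCorner (D : Set G.Edge) : Type u :=
  {c : G.Corner // ∀ d, G.vert d = G.vert c → G.edge d ∈ D}

/-- The corners on boundary components that touch only edges in `D`. -/
def StrippedBoundaryCorner (D : Set G.Edge) : Type u :=
  {c : G.Corner // ∀ d, G.bdry d = G.bdry c → G.edge d ∈ D}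

instance (D : Set G.Edge) : Finite (G.StrippedVertexCorner D) :=
  inferInstanceAs (Finite {_c : G.Corner // _})

instance (D : Set G.Edge) : Finite (G.StrippedBoundaryCorner D) :=
  inferInstanceAs (Finite {_c : G.Corner // _})

/-- The vertices that become isolated when the edges in `D` are deleted. -/
def StrippedVertex (D : Set G.Edge) : Type u :=
  Quot fun c d : G.StrippedVertexCorner D => d.1 = G.t1 c.1 ∨ d.1 = G.t2 c.1

/-- The boundary components that touch only edges in `D`. When `D` is contracted, the discs glued
to them are isolated vertices. -/
def StrippedBoundary (D : Set G.Edge) : Type u :=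
  Quot fun c d : G.StrippedBoundaryCorner D => d.1 = G.t1 c.1 ∨ d.1 = G.t0 c.1

instance (D : Set G.Edge) : Finite (G.StrippedVertex D) := inferInstanceAs (Finite (Quot _))

instance (D : Set G.Edge) : Finite (G.StrippedBoundary D) := inferInstanceAs (Finite (Quot _))

/-- Deletion of the edges in `D`. The vertex discs are unchanged: an arc of a vertex boundary now
runs on across the attaching segments of deleted edges. -/
@[reducible]
noncomputable def delete (D : Set G.Edge) : RibbonGraph.{u} where
  Corner := {c : G.Corner // G.edge c ∉ D}
  Edge := {e : G.Edge // e ∉ D}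
  Isolated := G.Isolated ⊕ G.StrippedVertex D
  edge c := ⟨G.edge c.1, c.2⟩
  t0 c := ⟨G.t0 c.1, (G.keep_t0 D c.1).2 c.2⟩
  t1 c := ⟨skip G.t1 G.t2 (G.keep D) c.1, skip_mem G.t1_invol G.t2_invol (G.keep_t2 D) c.2⟩
  t2 c := ⟨G.t2 c.1, (G.keep_t2 D c.1).2 c.2⟩
  t0_invol c := Subtype.ext (G.t0_invol c.1)
  t1_invol c := Subtype.ext (skip_invol G.t1_invol G.t2_invol (G.keep_t2 D) c.2)
  t2_invol c := Subtype.ext (G.t2_invol c.1)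
  t0_ne c h := G.t0_ne c.1 (congrArg Subtype.val h)
  t1_ne c h := skip_ne G.t1_invol G.t1_ne G.t2_invol G.t2_ne (G.keep_t2 D) c.2
    (congrArg Subtype.val h)
  t2_ne c h := G.t2_ne c.1 (congrArg Subtype.val h)
  t0_ne_t2 c h := G.t0_ne_t2 c.1 (congrArg Subtype.val h)
  t0_t2 c := Subtype.ext (G.t0_t2 c.1)
  edge_surj e := by
    obtain ⟨c, hc⟩ := G.edge_surj e.1
    exact ⟨⟨c, by rw [hc]; exact e.2⟩, Subtype.ext hc⟩
  edge_eq_iff c d := by simpa only [Subtype.ext_iff] using G.edge_eq_iff c.1 d.1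

/-- Contraction of the edges in `D`. These edges and their vertices are removed and a disc is glued
to every boundary component of the ribbon subgraph that they form: an arc of the boundary of a new
vertex runs along arcs of old vertices and free sides of contracted edges. -/
@[reducible]
noncomputable def contract (D : Set G.Edge) : RibbonGraph.{u} where
  Corner := {c : G.Corner // G.edge c ∉ D}
  Edge := {e : G.Edge // e ∉ D}
  Isolated := G.Isolated ⊕ G.StrippedBoundary D
  edge c := ⟨G.edge c.1, c.2⟩
  t0 c := ⟨G.t0 c.1, (G.keep_t0 D c.1).2 c.2⟩
  t1 c := ⟨skip G.t1 G.t0 (G.keep D) c.1, skip_mem G.t1_invol G.t0_invol (G.keep_t0 D) c.2⟩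
  t2 c := ⟨G.t2 c.1, (G.keep_t2 D c.1).2 c.2⟩
  t0_invol c := Subtype.ext (G.t0_invol c.1)
  t1_invol c := Subtype.ext (skip_invol G.t1_invol G.t0_invol (G.keep_t0 D) c.2)
  t2_invol c := Subtype.ext (G.t2_invol c.1)
  t0_ne c h := G.t0_ne c.1 (congrArg Subtype.val h)
  t1_ne c h := skip_ne G.t1_invol G.t1_ne G.t0_invol G.t0_ne (G.keep_t0 D) c.2
    (congrArg Subtype.val h)
  t2_ne c h := G.t2_ne c.1 (congrArg Subtype.val h)
  t0_ne_t2 c h := G.t0_ne_t2 c.1 (congrArg Subtype.val h)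
  t0_t2 c := Subtype.ext (G.t0_t2 c.1)
  edge_surj e := by
    obtain ⟨c, hc⟩ := G.edge_surj e.1
    exact ⟨⟨c, by rw [hc]; exact e.2⟩, Subtype.ext hc⟩
  edge_eq_iff c d := by simpa only [Subtype.ext_iff] using G.edge_eq_iff c.1 d.1

end RibbonGraph

/-! ### Rank functions of graphs -/

/-- The number of components of the spanning subgraph of `H` with edge set `A`. -/
noncomputable def graphComponents {V E : Type*} (H : Graph V E) (A : Set E) : ℕ :=
  Nat.card (Quot fun u v : H.vertexSet => ∃ e ∈ A, H.IsLink e u v)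

/-- The rank function `r_H(A) = v(H) - k(A)`. -/
noncomputable def graphRank {V E : Type*} (H : Graph V E) (A : Set E) : ℚ :=
  (Nat.card H.vertexSet : ℚ) - graphComponents H A

/-- The graph whose vertices are the points of `X`, restricted to `W`, in which the edge `e` joins
the points `f c` and `f (t c)` for the corners `c` of `e`; here `t` is one of `t0`, `t2` and `f` does
not change along the other one. -/
def cornerGraph {C E X : Type*} (edge : C → E) (t t' : C → C) (f : C → X) (W : Set X)
    (ht : ∀ c, t (t c) = c) (het : ∀ c, edge (t c) = edge c)
    (hfib : ∀ c d, edge d = edge c → d = c ∨ d = t c ∨ d = t' c ∨ d = t (t' c))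
    (hf : ∀ c, f (t' c) = f c) (hW : ∀ c, f c ∈ W) :
    Graph X E where
  vertexSet := W
  IsLink e x y := ∃ c, edge c = e ∧ f c = x ∧ f (t c) = y
  isLink_symm _ _ := ⟨by
    rintro x y ⟨c, rfl, rfl, rfl⟩
    exact ⟨t c, het c, rfl, by rw [ht]⟩⟩
  eq_or_eq_of_isLink_of_isLink := by
    rintro e x y v w ⟨c, rfl, rfl, rfl⟩ ⟨d, hd, rfl, rfl⟩
    rcases hfib c d hd with rfl | rfl | rfl | rfl
    · exact Or.inl rfl
    · exact Or.inr (by rw [ht])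
    · exact Or.inl (hf c).symm
    · exact Or.inr (by rw [ht, hf])
  left_mem_of_isLink := by
    rintro e x y ⟨c, -, rfl, -⟩
    exact hW c

namespace RibbonGraph

variable (G : RibbonGraph.{u})

theorem fibre_t0 (c d : G.Corner) (h : G.edge d = G.edge c) :
    d = c ∨ d = G.t0 c ∨ d = G.t2 c ∨ d = G.t0 (G.t2 c) := (G.edge_eq_iff c d).1 h

theorem fibre_t2 (c d : G.Corner) (h : G.edge d = G.edge c) :
    d = c ∨ d = G.t2 c ∨ d = G.t0 c ∨ d = G.t2 (G.t0 c) := by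
  have := G.fibre_t0 c d h
  rw [G.t0_t2] at this
  tauto

/-- The underlying abstract graph. -/
def graph : Graph G.Vertex G.Edge :=
  cornerGraph G.edge G.t0 G.t2 G.vert Set.univ G.t0_invol G.edge_t0 G.fibre_t0 G.vert_t2
    (fun _ => Set.mem_univ _)

/-- The Euler genus, `γ = 2k - |V| + |E| - b`. -/
noncomputable def eulerGenus : ℚ :=
  2 * (graphComponents G.graph Set.univ : ℚ) - Nat.card G.Vertex + Nat.card G.Edge
    - Nat.card G.Boundary

/-- `ρ(G) = r(G) + γ(G) / 2`. -/
noncomputable def rho : ℚ := graphRank G.graph Set.univ + G.eulerGenus / 2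

/-- `ρ(A) = ρ(G \ Aᶜ)`. -/
noncomputable def rhoSet (A : Set G.Edge) : ℚ := (G.delete Aᶜ).rho

end RibbonGraph

/-! ### Coloured ribbon graphs -/

/-- A ribbon graph with a vertex colouring and a boundary colouring. The colour classes are the
nonempty fibres of `vcol` and `bcol`. -/
structure ColouredRibbonGraph extends RibbonGraph.{u} where
  /-- The set of colours for vertices. -/
  VColour : Type u
  /-- The set of colours for boundary components. -/
  BColour : Type u
  /-- The vertex colouring. -/
  vcol : toRibbonGraph.Vertex → VColour
  /-- The boundary colouring. -/
  bcol : toRibbonGraph.Boundary → BColour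

namespace ColouredRibbonGraph

variable (G : ColouredRibbonGraph.{u})

/-- The colour of the vertex at a corner. -/
def vcolAt (c : G.Corner) : G.VColour := G.vcol (G.vert c)

/-- The colour of the boundary component at a corner. -/
def bcolAt (c : G.Corner) : G.BColour := G.bcol (G.bdry c)

/-- The coloured geometric dual. The vertices of the dual ribbon graph are the boundary components
of `G` and its boundary components are the vertices of `G`; they keep their colours. -/
@[reducible]
def dual : ColouredRibbonGraph.{u} where
  toRibbonGraph := G.toRibbonGraph.dual
  VColour := G.BColour
  BColour := G.VColour
  vcol := G.bcol
  bcol := G.vcol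

/-- The graph `G/𝒱` on the vertex colour classes. -/
def vertexClassGraph : Graph G.VColour G.Edge :=
  cornerGraph G.edge G.t0 G.t2 G.vcolAt (Set.range G.vcol) G.t0_invol G.edge_t0 G.fibre_t0
    (fun c => congrArg G.vcol (G.vert_t2 c))
    (fun c => ⟨G.vert c, rfl⟩)

/-- The graph `G*/ℬ` on the boundary colour classes: each edge of `G` joins the classes of the
boundary components along its two free sides. -/
def boundaryClassGraph : Graph G.BColour G.Edge :=
  cornerGraph G.edge G.t2 G.t0 G.bcolAt (Set.range G.bcol) G.t2_invol G.edge_t2 G.fibre_t2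
    (fun c => congrArg G.bcol (G.bdry_t0 c))
    (fun c => ⟨G.bdry c, rfl⟩)

/-- `r₁(A)`, the rank of `A` in `G/𝒱`. -/
noncomputable def r1 (A : Set G.Edge) : ℚ := graphRank G.vertexClassGraph A

/-- `r₂(A) = ρ(A) - r_{G/𝒱}(A)`. -/
noncomputable def r2 (A : Set G.Edge) : ℚ := G.rhoSet A - graphRank G.vertexClassGraph A

/-- `r₃(A) = r_{G*/ℬ}(E) - r_{G*/ℬ}(Aᶜ)`. -/
noncomputable def r3 (A : Set G.Edge) : ℚ :=
  graphRank G.boundaryClassGraph Set.univ - graphRank G.boundaryClassGraph Aᶜ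

/-- `r₄(A) = |A| + r_{G*/ℬ}(Aᶜ) - r_{G*/ℬ}(E) - ρ(A)`. -/
noncomputable def r4 (A : Set G.Edge) : ℚ :=
  (A.ncard : ℚ) + graphRank G.boundaryClassGraph Aᶜ - graphRank G.boundaryClassGraph Set.univ
    - G.rhoSet A

/-- The monomial `w ^ q`, for an indeterminate `w` and a rational exponent `q`, in the ring of
polynomial expressions with integer coefficients and rational exponents. -/
noncomputable def power {σ : Type*} (w : σ) (q : ℚ) : AddMonoidAlgebra ℤ (σ →₀ ℚ) :=
  AddMonoidAlgebra.single (Finsupp.single w q) 1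

/-- The Tutte polynomial `T_ps(G; w, x, y, z)` in the indeterminates `w, x, y, z`. The sum is over
the finitely many subsets `A` of the edge set. -/
noncomputable def tutte {σ : Type*} (w x y z : σ) : AddMonoidAlgebra ℤ (σ →₀ ℚ) :=
  ∑ᶠ A : Set G.Edge,
    power w (G.r1 Set.univ - G.r1 A) * power x (G.r2 Set.univ - G.r2 A) *
      power y (G.r3 A) * power z (G.r4 A)

/-! ### Deletion, contraction and edge types -/

/-- The boundary colours after deletion of `D`: the colours on the two sides of each deleted edge are
merged. -/
def MergedBColour (D : Set G.Edge) : Type u :=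
  Quot fun a b : G.BColour => ∃ c, G.edge c ∈ D ∧ a = G.bcolAt c ∧ b = G.bcolAt (G.t2 c)

/-- The vertex colours after contraction of `D`: the colours at the two ends of each contracted edge
are merged. -/
def MergedVColour (D : Set G.Edge) : Type u :=
  Quot fun a b : G.VColour => ∃ c, G.edge c ∈ D ∧ a = G.vcolAt c ∧ b = G.vcolAt (G.t0 c)

/-- The merged boundary colour at a corner. -/
def mergedBColAt (D : Set G.Edge) (c : G.Corner) : G.MergedBColour D := Quot.mk _ (G.bcolAt c)

/-- The merged vertex colour at a corner. -/
def mergedVColAt (D : Set G.Edge) (c : G.Corner) : G.MergedVColour D := Quot.mk _ (G.vcolAt c)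

theorem vcolAt_t1 (c : G.Corner) : G.vcolAt (G.t1 c) = G.vcolAt c :=
  congrArg G.vcol (G.vert_t1 c)

theorem vcolAt_t2 (c : G.Corner) : G.vcolAt (G.t2 c) = G.vcolAt c :=
  congrArg G.vcol (G.vert_t2 c)

theorem bcolAt_t1 (c : G.Corner) : G.bcolAt (G.t1 c) = G.bcolAt c :=
  congrArg G.bcol (G.bdry_t1 c)

theorem bcolAt_t0 (c : G.Corner) : G.bcolAt (G.t0 c) = G.bcolAt c :=
  congrArg G.bcol (G.bdry_t0 c)

theorem mergedBColAt_t1 (D : Set G.Edge) (c : G.Corner) :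
    G.mergedBColAt D (G.t1 c) = G.mergedBColAt D c :=
  congrArg (Quot.mk _) (G.bcolAt_t1 c)

theorem mergedBColAt_t0 (D : Set G.Edge) (c : G.Corner) :
    G.mergedBColAt D (G.t0 c) = G.mergedBColAt D c :=
  congrArg (Quot.mk _) (G.bcolAt_t0 c)

theorem mergedBColAt_t2 {D : Set G.Edge} {c : G.Corner} (h : G.edge c ∈ D) :
    G.mergedBColAt D (G.t2 c) = G.mergedBColAt D c :=
  (Quot.sound ⟨c, h, rfl, rfl⟩).symm

theorem mergedVColAt_t1 (D : Set G.Edge) (c : G.Corner) :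
    G.mergedVColAt D (G.t1 c) = G.mergedVColAt D c :=
  congrArg (Quot.mk _) (G.vcolAt_t1 c)

theorem mergedVColAt_t2 (D : Set G.Edge) (c : G.Corner) :
    G.mergedVColAt D (G.t2 c) = G.mergedVColAt D c :=
  congrArg (Quot.mk _) (G.vcolAt_t2 c)

theorem mergedVColAt_t0 {D : Set G.Edge} {c : G.Corner} (h : G.edge c ∈ D) :
    G.mergedVColAt D (G.t0 c) = G.mergedVColAt D c :=
  (Quot.sound ⟨c, h, rfl, rfl⟩).symm

/-- Deletion of the edges in `D` from a coloured ribbon graph. Vertices keep their colours. A new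
boundary component gets the merged colour of the old boundary components that it runs along. -/
@[reducible]
noncomputable def delete (D : Set G.Edge) : ColouredRibbonGraph.{u} where
  toRibbonGraph := G.toRibbonGraph.delete D
  VColour := G.VColour
  BColour := G.MergedBColour D
  vcol := Sum.elim
    (Quot.lift (fun c => G.vcolAt c.1) (by
      rintro c d (rfl | rfl)
      · exact (skip_invariant G.vcolAt G.vcolAt_t1 (fun c _ => G.vcolAt_t2 c) c.1).symm
      · exact (G.vcolAt_t2 c.1).symm))
    (Sum.elim (fun i => G.vcol (Sum.inr i))
      (Quot.lift (fun c => G.vcolAt c.1) (by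
        rintro c d (h | h)
        · exact (h ▸ G.vcolAt_t1 c.1).symm
        · exact (h ▸ G.vcolAt_t2 c.1).symm)))
  bcol := Sum.elim
    (Quot.lift (fun c => G.mergedBColAt D c.1) (by
      rintro c d (rfl | rfl)
      · exact (skip_invariant (G.mergedBColAt D) (G.mergedBColAt_t1 D)
          (fun c hc => G.mergedBColAt_t2 (not_not.1 hc)) c.1).symm
      · exact (G.mergedBColAt_t0 D c.1).symm))
    (Sum.elim (fun i => Quot.mk _ (G.bcol (Sum.inr i)))
      (Quot.lift (fun c => G.mergedBColAt D c.1) (by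
        rintro c d (h | h)
        · exact (h ▸ G.mergedBColAt_t1 D c.1).symm
        · exact (h ▸ G.mergedBColAt_t2 (c.2 c.1 rfl)).symm)))

/-- Contraction of the edges in `D` in a coloured ribbon graph. Boundary components keep their
colours. A new vertex gets the merged colour of the old vertices that its boundary runs along. -/
@[reducible]
noncomputable def contract (D : Set G.Edge) : ColouredRibbonGraph.{u} where
  toRibbonGraph := G.toRibbonGraph.contract D
  VColour := G.MergedVColour D
  BColour := G.BColour
  vcol := Sum.elim
    (Quot.lift (fun c => G.mergedVColAt D c.1) (by
      rintro c d (rfl | rfl)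
      · exact (skip_invariant (G.mergedVColAt D) (G.mergedVColAt_t1 D)
          (fun c hc => G.mergedVColAt_t0 (not_not.1 hc)) c.1).symm
      · exact (G.mergedVColAt_t2 D c.1).symm))
    (Sum.elim (fun i => Quot.mk _ (G.vcol (Sum.inr i)))
      (Quot.lift (fun c => G.mergedVColAt D c.1) (by
        rintro c d (h | h)
        · exact (h ▸ G.mergedVColAt_t1 D c.1).symm
        · exact (h ▸ G.mergedVColAt_t0 (c.2 c.1 rfl)).symm)))
  bcol := Sum.elim
    (Quot.lift (fun c => G.bcolAt c.1) (by
      rintro c d (rfl | rfl)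
      · exact (skip_invariant G.bcolAt G.bcolAt_t1 (fun c _ => G.bcolAt_t0 c) c.1).symm
      · exact (G.bcolAt_t0 c.1).symm))
    (Sum.elim (fun i => G.bcol (Sum.inr i))
      (Quot.lift (fun c => G.bcolAt c.1) (by
        rintro c d (h | h)
        · exact (h ▸ G.bcolAt_t1 c.1).symm
        · exact (h ▸ G.bcolAt_t0 c.1).symm)))

end ColouredRibbonGraph

/-- Equivalence of coloured ribbon graphs after their isolated vertices are discarded. A bijection of
corners that respects `t0, t1, t2` induces bijections of edges, of non-isolated vertices and of the
boundary components that touch an edge; these have to preserve the colour classes. -/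
def EquivalentUpToIsolated (G : ColouredRibbonGraph.{u})
    (H : ColouredRibbonGraph.{0}) : Prop :=
  ∃ φ : G.Corner ≃ H.Corner,
    (∀ c, φ (G.t0 c) = H.t0 (φ c)) ∧ (∀ c, φ (G.t1 c) = H.t1 (φ c)) ∧
    (∀ c, φ (G.t2 c) = H.t2 (φ c)) ∧
    (∀ c d, G.vcolAt c = G.vcolAt d ↔ H.vcolAt (φ c) = H.vcolAt (φ d)) ∧
    (∀ c d, G.bcolAt c = G.bcolAt d ↔ H.bcolAt (φ c) = H.bcolAt (φ d))

/-- The names of the connected coloured ribbon graphs on one edge: bridge surface, bridge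
pseudo-surface, orientable loop cellular, orientable loop handle, non-orientable loop. -/
inductive EdgeKind
  | bs | bp | olc | olh | nl

namespace EdgeKind

/-- The exchange `bs ↔ olc`, `bp ↔ olh`, with `nl` fixed. -/
def swap : EdgeKind → EdgeKind
  | bs => olc
  | bp => olh
  | olc => bs
  | olh => bp
  | nl => nl

/-- How the arcs of the vertex boundary join the corners of the edge. The corner `(i, s)` is at the
end `i` and on the side `s` of the edge. For a bridge each arc returns to the same end, for an
orientable loop it joins the two ends on the same side, and for a non-orientable loop it joins the
two ends on opposite sides. -/
def arc : EdgeKind → Bool × Bool → Bool × Bool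
  | bs, c => (c.1, !c.2)
  | bp, c => (c.1, !c.2)
  | olc, c => (!c.1, c.2)
  | olh, c => (!c.1, c.2)
  | nl, c => (!c.1, !c.2)

/-- The ribbon graph with one edge of the given kind. -/
@[reducible]
def ribbon (k : EdgeKind) : RibbonGraph.{0} where
  Corner := Bool × Bool
  Edge := Unit
  Isolated := Empty
  edge _ := ()
  t0 c := (!c.1, c.2)
  t1 := k.arc
  t2 c := (c.1, !c.2)
  t0_invol := by decide
  t1_invol := by cases k <;> decide
  t2_invol := by decide
  t0_ne := by decide
  t1_ne := by cases k <;> decide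
  t2_ne := by decide
  t0_ne_t2 := by decide
  t0_t2 := by decide
  edge_surj := by decide
  edge_eq_iff := by decide

/-- The colour of the vertex at a corner: the two vertices of `bs` have different colours and those
of `bp` the same one; the others have a single vertex. -/
def vcolour : EdgeKind → Bool × Bool → Bool
  | bs, c => c.1
  | _, _ => true

/-- The colour of the boundary component at a corner: the two boundary components of `olc` have
different colours and those of `olh` the same one; the others have a single boundary component. -/
def bcolour : EdgeKind → Bool × Bool → Bool
  | olc, c => c.2
  | _, _ => true

/-- The coloured ribbon graph with one edge of the given kind. -/
@[reducible]
def model (k : EdgeKind) : ColouredRibbonGraph.{0} where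
  toRibbonGraph := k.ribbon
  VColour := Bool
  BColour := Bool
  vcol := Sum.elim (Quot.lift k.vcolour (by
    rintro c d (rfl | rfl) <;> revert c <;> cases k <;> decide)) Empty.elim
  bcol := Sum.elim (Quot.lift k.bcolour (by
    rintro c d (rfl | rfl) <;> revert c <;> cases k <;> decide)) Empty.elim

end EdgeKind

/-- The edge `e` is of type `(i, j)`: up to isolated vertices, `G / eᶜ` is `i` and `G \ eᶜ` is
`j`. -/
def ColouredRibbonGraph.HasType (G : ColouredRibbonGraph.{u}) (e : G.Edge) (i j : EdgeKind) : Prop :=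
  EquivalentUpToIsolated (G.contract {e}ᶜ) i.model ∧ EquivalentUpToIsolated (G.delete {e}ᶜ) j.model

/-! Duality rests on the identity `ρ*(A) = |A| + ρ(Aᶜ) - ρ(E)` for the functions `ρ`, `ρ*` of a
ribbon graph and its dual (`RibbonGraph.rhoSet_dual`). In `r + γ/2` the number of components
cancels, leaving `ρ = (|V| + |E| - b)/2`. Hence only the number `b(A)` of boundary components of the
spanning ribbon subgraph on `A` has to be understood. Isolated vertices of `G` aside, `b(A)` counts
the orbits on all corners of `G` under `t1`, `t0` at edges of `A`, and `t2` at edges of `Aᶜ`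
(`card_boundary_delete`). Duality exchanges `t0` with `t2`, so complementing `A` leaves these orbits
unchanged (`mixedOrbits_dual`). The two colour class graphs trade places under duality by
definition. Together with the identity for `ρ`, this turns the exponents of `w, x, y, z` for `G*` at
`A` into those of `y, z, w, x` for `G` at `Aᶜ`, and the sum is reindexed by complementation. For
edge types, deletion and contraction are exchanged by dualising definitionally, so only the five
one-edge models need a check. The technical core is `card_mixedStep`, which compares orbits of
first-return maps on the kept corners with orbits on all corners. -/

section ReturnMap

/-! ### Paths that meet `S`, and invariance of their endpoints -/

variable {C : Type*}

/-- Whether the path from `c` meets `S` after the initial step. -/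
def Reaches (t s : C → C) (S : Set C) (c : C) : Prop :=
  ∃ n : ℕ, (skipStep t s S)^[n + 1] c ∈ S

theorem skip_mem_of_reaches {t s : C → C} {S : Set C} {c : C} (h : Reaches t s S c) :
    skip t s S c ∈ S := by
  obtain ⟨n, h1, h2, -⟩ := skip_spec h
  rw [h1]; exact h2

theorem reaches_of_mem [Finite C] {t s : C → C} {S : Set C} (ht : Function.Involutive t)
    (hs : Function.Involutive s) (hS : ∀ c, s c ∈ S ↔ c ∈ S) {c : C} (hc : c ∈ S) :
    Reaches t s S c := exists_return ht hs hS hc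

theorem reaches_skipStep_iff [Finite C] {t s : C → C} {S : Set C} (ht : Function.Involutive t)
    (hs : Function.Involutive s) (hS : ∀ c, s c ∈ S ↔ c ∈ S) (c : C) :
    Reaches t s S (skipStep t s S c) ↔ Reaches t s S c := by
  constructor
  · rintro ⟨n, hn⟩
    exact ⟨n + 1, by rwa [Function.iterate_succ_apply]⟩
  · rintro ⟨n, hn⟩
    rcases n with _ | n
    -- Here the next point already lies in `S`, but the start of a path does not count as a meeting;
    -- finiteness brings the path back.
    · exact reaches_of_mem ht hs hS hn
    · exact ⟨n, by rwa [Function.iterate_succ_apply] at hn⟩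

theorem reaches_iterate_iff [Finite C] {t s : C → C} {S : Set C} (ht : Function.Involutive t)
    (hs : Function.Involutive s) (hS : ∀ c, s c ∈ S ↔ c ∈ S) (n : ℕ) (c : C) :
    Reaches t s S ((skipStep t s S)^[n] c) ↔ Reaches t s S c := by
  induction n with
  | zero => rfl
  | succ n ih => rw [Function.iterate_succ_apply', reaches_skipStep_iff ht hs hS, ih]

/-- If the path from `c` ends at `skip t s S c`, then the path back ends at the crossing of `c`. -/
theorem exists_iterate_skip {t s : C → C} {S : Set C} (ht : Function.Involutive t)
    (hs : Function.Involutive s) (hS : ∀ c, s c ∈ S ↔ c ∈ S) {c : C} (h : Reaches t s S c) :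
    ∃ n : ℕ, skip t s S c = (skipStep t s S)^[n] c ∧
      skipCross s S c = (skipStep t s S)^[n] (skip t s S c) := by
  obtain ⟨n, h1, h2, -⟩ := skip_spec h
  refine ⟨n + 1, h1, ?_⟩
  have hrev := skip_reverse (t := t) ht hs hS (n + 1) (n + 1) le_rfl c
  rw [skipCross_of_mem h2, Nat.sub_self] at hrev
  rw [h1, hrev]; rfl

/-- The path walked back from `skip t s S c` runs through the crossing of `c`. It starts in `S`, so
it returns to `S`, and so does the path from each of its points. -/
theorem Reaches.skipCross [Finite C] {t s : C → C} {S : Set C} (ht : Function.Involutive t)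
    (hs : Function.Involutive s) (hS : ∀ c, s c ∈ S ↔ c ∈ S) {c : C} (h : Reaches t s S c) :
    Reaches t s S (skipCross s S c) := by
  obtain ⟨n, -, h2⟩ := exists_iterate_skip ht hs hS h
  rw [h2, reaches_iterate_iff ht hs hS]
  exact reaches_of_mem ht hs hS (skip_mem_of_reaches h)

theorem reaches_skipCross_iff [Finite C] {t s : C → C} {S : Set C} (ht : Function.Involutive t)
    (hs : Function.Involutive s) (hS : ∀ c, s c ∈ S ↔ c ∈ S) (c : C) :
    Reaches t s S (skipCross s S c) ↔ Reaches t s S c := by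
  refine ⟨fun h => ?_, fun h => h.skipCross ht hs hS⟩
  have := h.skipCross ht hs hS
  rwa [skipCross_invol hs hS] at this

/-- Crossing is an involution, so `t` factors as a crossing followed by a step. Facts about `t` thus
reduce to facts about `skipCross` and `skipStep`. -/
theorem apply_eq_skipStep {t s : C → C} {S : Set C} (hs : Function.Involutive s)
    (hS : ∀ c, s c ∈ S ↔ c ∈ S) (c : C) : t c = skipStep t s S (skipCross s S c) := by
  rw [skipStep_eq, skipCross_invol hs hS]

theorem reaches_apply_iff [Finite C] {t s : C → C} {S : Set C} (ht : Function.Involutive t)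
    (hs : Function.Involutive s) (hS : ∀ c, s c ∈ S ↔ c ∈ S) (c : C) :
    Reaches t s S (t c) ↔ Reaches t s S c := by
  rw [apply_eq_skipStep (t := t) hs hS c, reaches_skipStep_iff ht hs hS,
    reaches_skipCross_iff ht hs hS]

theorem reaches_apply_iff' [Finite C] {t s : C → C} {S : Set C} (ht : Function.Involutive t)
    (hs : Function.Involutive s) (hS : ∀ c, s c ∈ S ↔ c ∈ S) (c : C) :
    Reaches t s S (s c) ↔ Reaches t s S c := by
  by_cases h : c ∈ S
  · exact iff_of_true (reaches_of_mem ht hs hS ((hS c).2 h)) (reaches_of_mem ht hs hS h)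
  · rw [← skipCross_of_notMem (s := s) h, reaches_skipCross_iff ht hs hS]

/-- The points whose path never meets `S` are those whose orbit under `t` and `s` avoids `S`. -/
theorem not_reaches_iff [Finite C] {t s : C → C} {S : Set C} (ht : Function.Involutive t)
    (hs : Function.Involutive s) (hS : ∀ c, s c ∈ S ↔ c ∈ S) (c : C) :
    ¬ Reaches t s S c ↔ ∀ d, (Quot.mk (fun a b => b = t a ∨ b = s a) d : Quot _) =
      Quot.mk (fun a b => b = t a ∨ b = s a) c → d ∉ S := by
  constructor
  · intro h d hd hdS
    -- Being constant on orbits, `Reaches` descends to a `Prop`-valued function on the quotient,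
    -- which can be applied to `hd`.
    have key : Reaches t s S d = Reaches t s S c :=
      congrArg (Quot.lift (Reaches t s S) (by
        rintro a b (rfl | rfl)
        · exact propext (reaches_apply_iff ht hs hS a).symm
        · exact propext (reaches_apply_iff' ht hs hS a).symm)) hd
    exact h (key ▸ reaches_of_mem ht hs hS hdS)
  · rintro h ⟨n, hn⟩
    refine h _ ?_ hn
    generalize n + 1 = m
    induction m with
    | zero => rfl
    | succ m ih =>
      rw [← ih, Function.iterate_succ_apply', skipStep_eq]
      refine (Quot.sound (r := fun a b => b = t a ∨ b = s a) (Or.inl rfl)).symm.trans ?_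
      by_cases hm : (skipStep t s S)^[m] c ∈ S
      · rw [skipCross_of_mem hm]
      · rw [skipCross_of_notMem hm]
        exact (Quot.sound (r := fun a b => b = t a ∨ b = s a) (Or.inr rfl)).symm

/-- A function on `S` that agrees on first returns takes the same value at the ends of the paths
from `c` and from the next point on the path. -/
theorem mk_skip_skipStep {t s : C → C} {S : Set C} {X : Type*} (g : S → X)
    (hg : ∀ c d : S, d.1 = skip t s S c.1 → g d = g c) {c d : C} (hd : d = skipStep t s S c)
    (h : Reaches t s S c) (h' : Reaches t s S d) :
    g ⟨skip t s S d, skip_mem_of_reaches h'⟩ = g ⟨skip t s S c, skip_mem_of_reaches h⟩ := by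
  subst hd
  by_cases hm : skipStep t s S c ∈ S
  · have h1 : skip t s S c = skipStep t s S c := skip_eq (n := 0) hm (by simp)
    exact hg ⟨_, skip_mem_of_reaches h⟩ ⟨_, skip_mem_of_reaches h'⟩ (congrArg (skip t s S) h1.symm)
  -- The path from `d` is now the path from `c` without its first step, so both have the same
  -- endpoint.
  · congr 2
    obtain ⟨n, hn, hn1, hn2⟩ := skip_spec h'
    rw [hn, skip_eq (n := n + 1)]
    · exact (Function.iterate_succ_apply _ _ _).symm
    · rwa [Function.iterate_succ_apply]
    · intro k hk
      rcases k with _ | k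
      · exact hm
      · rw [Function.iterate_succ_apply]
        exact hn2 k (by omega)

theorem mk_skip_iterate [Finite C] {t s : C → C} {S : Set C} (ht : Function.Involutive t)
    (hs : Function.Involutive s) (hS : ∀ c, s c ∈ S ↔ c ∈ S) {X : Type*} (g : S → X)
    (hg : ∀ c d : S, d.1 = skip t s S c.1 → g d = g c) (n : ℕ) {c d : C}
    (hd : d = (skipStep t s S)^[n] c) (h : Reaches t s S c) (h' : Reaches t s S d) :
    g ⟨skip t s S d, skip_mem_of_reaches h'⟩ = g ⟨skip t s S c, skip_mem_of_reaches h⟩ := by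
  induction n generalizing d with
  | zero => subst hd; rfl
  | succ n ih =>
    rw [← ih rfl ((reaches_iterate_iff ht hs hS n c).2 h)]
    exact mk_skip_skipStep g hg (by rw [hd, Function.iterate_succ_apply'])
      ((reaches_iterate_iff ht hs hS n c).2 h) h'

/-- The crossing of `c` lies on the path from `skip t s S c`, so its endpoint has the same value as
the second return of `c`, which `hg` identifies with the first. -/
theorem mk_skip_skipCross [Finite C] {t s : C → C} {S : Set C} (ht : Function.Involutive t)
    (hs : Function.Involutive s) (hS : ∀ c, s c ∈ S ↔ c ∈ S) {X : Type*} (g : S → X)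
    (hg : ∀ c d : S, d.1 = skip t s S c.1 → g d = g c) {c d : C} (hd : d = skipCross s S c)
    (h : Reaches t s S c) (h' : Reaches t s S d) :
    g ⟨skip t s S d, skip_mem_of_reaches h'⟩ = g ⟨skip t s S c, skip_mem_of_reaches h⟩ := by
  obtain ⟨n, h1, h2⟩ := exists_iterate_skip ht hs hS h
  have h3 := reaches_of_mem ht hs hS (skip_mem_of_reaches h)
  rw [mk_skip_iterate ht hs hS g hg n (hd.trans h2) h3 h']
  exact hg _ _ rfl

theorem mk_skip_apply [Finite C] {t s : C → C} {S : Set C} (ht : Function.Involutive t)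
    (hs : Function.Involutive s) (hS : ∀ c, s c ∈ S ↔ c ∈ S) {X : Type*} (g : S → X)
    (hg : ∀ c d : S, d.1 = skip t s S c.1 → g d = g c) {c d : C} (hd : d = t c)
    (h : Reaches t s S c) (h' : Reaches t s S d) :
    g ⟨skip t s S d, skip_mem_of_reaches h'⟩ = g ⟨skip t s S c, skip_mem_of_reaches h⟩ := by
  have h1 := h.skipCross ht hs hS
  rw [← mk_skip_skipCross ht hs hS g hg rfl h h1]
  exact mk_skip_skipStep g hg (hd.trans (apply_eq_skipStep hs hS c)) h1 h'

/-! ### Counting orbits of mixed steps -/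

/-- The steps `t`, `s` outside `S` and `u` on `S`. -/
def MixedStep (t s u : C → C) (S : Set C) (c d : C) : Prop :=
  d = t c ∨ (c ∉ S ∧ d = s c) ∨ (c ∈ S ∧ d = u c)

theorem mk_skip_mixedStep {t s u : C → C} {S : Set C} (c : C) :
    (Quot.mk (MixedStep t s u S) (skip t s S c) : Quot _) = Quot.mk _ c :=
  skip_invariant (Quot.mk (MixedStep t s u S)) (fun _ => (Quot.sound (r := MixedStep t s u S) (Or.inl rfl)).symm)
    (fun _ h => (Quot.sound (r := MixedStep t s u S) (Or.inr (Or.inl ⟨h, rfl⟩))).symm) c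

/-- The orbits of the mixed steps are the orbits of the return map together with `u` on `S`, and
the orbits of `t` and `s` that avoid `S`. -/
theorem card_mixedStep [Finite C] {t s u : C → C} {S Z : Set C} (ht : Function.Involutive t)
    (hs : Function.Involutive s) (hS : ∀ c, s c ∈ S ↔ c ∈ S) (hu : ∀ c, u c ∈ S ↔ c ∈ S)
    (hZ : ∀ c, c ∈ Z ↔ ∀ d, (Quot.mk (fun a b => b = t a ∨ b = s a) d : Quot _) =
      Quot.mk (fun a b => b = t a ∨ b = s a) c → d ∉ S) :
    Nat.card (Quot (MixedStep t s u S)) =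
      Nat.card (Quot fun c d : S => d.1 = skip t s S c.1 ∨ d.1 = u c.1) +
      Nat.card (Quot fun c d : Z => d.1 = t c.1 ∨ d.1 = s c.1) := by
  classical
  have hZR : ∀ c, ¬ Reaches t s S c ↔ c ∈ Z := fun c =>
    (not_reaches_iff ht hs hS c).trans (hZ c).symm
  rw [← Nat.card_sum]
  let r : S → S → Prop := fun c d => d.1 = skip t s S c.1 ∨ d.1 = u c.1
  let q : Z → Z → Prop := fun c d => d.1 = t c.1 ∨ d.1 = s c.1
  have hg : ∀ c d : S, d.1 = skip t s S c.1 → (Quot.mk r d) = Quot.mk r c := fun c d h =>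
    (Quot.sound (r := r) (Or.inl h)).symm
  let f : C → Quot r ⊕ Quot q := fun c =>
    if h : Reaches t s S c then Sum.inl (Quot.mk r ⟨skip t s S c, skip_mem_of_reaches h⟩)
    else Sum.inr (Quot.mk q ⟨c, (hZR c).1 h⟩)
  have f_pos : ∀ c (h : Reaches t s S c),
      f c = Sum.inl (Quot.mk r ⟨skip t s S c, skip_mem_of_reaches h⟩) := fun c h => dif_pos h
  have f_neg : ∀ c (h : ¬ Reaches t s S c), f c = Sum.inr (Quot.mk q ⟨c, (hZR c).1 h⟩) :=
    fun c h => dif_neg h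
  -- On `S` the map `f` still uses the next return and not `c` itself; the two have the same class.
  have f_mem : ∀ c (h : c ∈ S), f c = Sum.inl (Quot.mk r ⟨c, h⟩) := fun c h => by
    rw [f_pos c (reaches_of_mem ht hs hS h)]
    exact congrArg Sum.inl (hg _ _ rfl)
  have hf : ∀ c d, MixedStep t s u S c d → f c = f d := by
    rintro c d (h | ⟨hc, h⟩ | ⟨hc, h⟩)
    · have hiff : Reaches t s S d ↔ Reaches t s S c := by rw [h, reaches_apply_iff ht hs hS]
      by_cases hr : Reaches t s S c
      · rw [f_pos c hr, f_pos d (hiff.2 hr)]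
        exact congrArg Sum.inl (mk_skip_apply ht hs hS _ hg h hr (hiff.2 hr)).symm
      · rw [f_neg c hr, f_neg d (mt hiff.1 hr)]
        exact congrArg Sum.inr (Quot.sound (Or.inl h))
    · have hiff : Reaches t s S d ↔ Reaches t s S c := by rw [h, reaches_apply_iff' ht hs hS]
      by_cases hr : Reaches t s S c
      · rw [f_pos c hr, f_pos d (hiff.2 hr)]
        exact congrArg Sum.inl (mk_skip_skipCross ht hs hS _ hg
          (h.trans (skipCross_of_notMem hc).symm) hr (hiff.2 hr)).symm
      · rw [f_neg c hr, f_neg d (mt hiff.1 hr)]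
        exact congrArg Sum.inr (Quot.sound (Or.inr h))
    · have hd : d ∈ S := by rw [h, hu]; exact hc
      rw [f_mem c hc, f_mem d hd]
      exact congrArg Sum.inl (Quot.sound (Or.inr h))
  refine Nat.card_congr
    { toFun := Quot.lift f hf
      invFun := Sum.elim
        (Quot.lift (fun c : S => Quot.mk _ c.1) (by
          intro (c : S) (d : S) h
          rcases h with h | h
          · rw [h, mk_skip_mixedStep]
          · exact Quot.sound (Or.inr (Or.inr ⟨c.2, h⟩))))
        (Quot.lift (fun c : Z => Quot.mk _ c.1) (by
          intro (c : Z) (d : Z) h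
          rcases h with h | h
          · exact Quot.sound (Or.inl h)
          -- Crossing by `s` is a mixed step here because points of `Z` lie outside `S`.
          · exact Quot.sound (Or.inr (Or.inl ⟨(hZ c.1).1 c.2 _ rfl, h⟩))))
      left_inv := ?_
      right_inv := ?_ }
  · rintro ⟨c⟩
    by_cases hr : Reaches t s S c
    · change Sum.elim _ _ (f c) = _
      rw [f_pos c hr]
      exact mk_skip_mixedStep c
    · change Sum.elim _ _ (f c) = _
      rw [f_neg c hr]
      rfl
  · intro x
    rcases x with x | x
    · induction x using Quot.ind with | mk c => exact f_mem c.1 c.2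
    · induction x using Quot.ind with | mk c => exact f_neg c.1 ((hZR c.1).2 c.2)

end ReturnMap

/-! ### Vertices, boundary components and the function `ρ` -/

namespace RibbonGraph

variable (G : RibbonGraph.{u})

instance : Finite G.VertexOrbit := inferInstanceAs (Finite (Quot _))

instance : Finite G.BoundaryOrbit := inferInstanceAs (Finite (Quot _))

/-- The number of components enters the rank with coefficient `-1` and half the Euler genus with
`+1`, so it cancels. -/
theorem rho_eq :
    G.rho = ((Nat.card G.Vertex : ℚ) + Nat.card G.Edge - Nat.card G.Boundary) / 2 := by
  have h : Nat.card G.graph.vertexSet = Nat.card G.Vertex :=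
    Nat.card_congr (Equiv.Set.univ G.Vertex)
  rw [rho, graphRank, eulerGenus, h]
  ring

/-- Puts the corners of stripped vertices in the form of the set `Z` in `card_mixedStep`. -/
theorem strippedVertexCorner_iff (D : Set G.Edge) (c : G.Corner) :
    c ∈ {c : G.Corner | ∀ d, G.vert d = G.vert c → G.edge d ∈ D} ↔
      ∀ d, (Quot.mk (fun a b => b = G.t1 a ∨ b = G.t2 a) d : Quot _) =
        Quot.mk (fun a b => b = G.t1 a ∨ b = G.t2 a) c → d ∉ G.keep D := by
  refine forall_congr' fun d => imp_congr ?_ not_not.symm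
  exact Sum.inl_injective.eq_iff

/-- The number of orbits of the arcs of the vertex boundaries, the attaching segments of the edges
in `D` and the free sides of the others. -/
noncomputable def mixedOrbits (D : Set G.Edge) : ℕ :=
  Nat.card (Quot (MixedStep G.t1 G.t2 G.t0 (G.keep D)))

/-- Boundary components of the deletion that meet an edge are orbits of the return map and `t0` on
kept corners. The orbits avoiding kept corners are the vertices that become isolated, each with one
boundary component. -/
theorem card_boundary_delete (D : Set G.Edge) :
    Nat.card (G.delete D).Boundary = G.mixedOrbits D + Nat.card G.Isolated := by
  rw [mixedOrbits, card_mixedStep G.t1_invol G.t2_invol (G.keep_t2 D) (G.keep_t0 D)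
    (G.strippedVertexCorner_iff D), Nat.card_sum, Nat.card_sum, add_comm (Nat.card G.Isolated),
    ← add_assoc]
  congr 2
  exact Nat.card_congr (Quot.congrRight fun c d => by simp only [Subtype.ext_iff])

/-- With `u = t2` the mixed steps no longer depend on `D` and their orbits are the old vertex
circles. -/
theorem card_vertex_delete (D : Set G.Edge) :
    Nat.card (G.delete D).Vertex = Nat.card G.Vertex := by
  have key := card_mixedStep (u := G.t2) G.t1_invol G.t2_invol (G.keep_t2 D) (G.keep_t2 D)
    (G.strippedVertexCorner_iff D)
  have h1 : Nat.card (Quot (MixedStep G.t1 G.t2 G.t2 (G.keep D))) = Nat.card G.VertexOrbit :=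
    Nat.card_congr (Quot.congrRight fun c d => by unfold MixedStep; tauto)
  rw [h1] at key
  rw [Nat.card_sum, Nat.card_sum, Nat.card_sum, key, add_comm (Nat.card G.Isolated), ← add_assoc]
  congr 2
  exact Nat.card_congr (Quot.congrRight fun c d => by simp only [Subtype.ext_iff])

/-- The two step relations on corners coincide: dualising swaps `t0` with `t2`, and complementing
swaps the corners where each is used. -/
theorem mixedOrbits_dual (D : Set G.Edge) : G.dual.mixedOrbits Dᶜ = G.mixedOrbits D :=
  Nat.card_congr (Quot.congrRight fun c d => by
    simp only [MixedStep, keep, Set.mem_ofPred_eq, Set.mem_compl_iff, not_not]; tauto)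

theorem mixedOrbits_empty : G.mixedOrbits ∅ = Nat.card G.BoundaryOrbit :=
  Nat.card_congr (Quot.congrRight fun c d => by simp [MixedStep, keep])

/-- The isolated vertices of `G` count equally as vertices and as boundary components, so only
orbits remain. -/
theorem rhoSet_eq (A : Set G.Edge) : G.rhoSet A =
    ((Nat.card G.VertexOrbit : ℚ) + A.ncard - G.mixedOrbits Aᶜ) / 2 := by
  have hE : Nat.card (G.delete Aᶜ).Edge = A.ncard := by
    rw [← Nat.card_coe_set_eq]
    exact Nat.card_congr (Equiv.subtypeEquivRight fun e => not_not)
  rw [rhoSet, rho_eq, card_vertex_delete, card_boundary_delete, hE, Nat.card_sum]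
  push_cast
  ring

theorem rhoSet_univ : G.rhoSet Set.univ =
    ((Nat.card G.VertexOrbit : ℚ) + Nat.card G.Edge - Nat.card G.BoundaryOrbit) / 2 := by
  rw [rhoSet_eq, Set.compl_univ, mixedOrbits_empty, Set.ncard_univ]

/-- The rank function of the dual ribbon graph is dual to that of the ribbon graph. -/
theorem rhoSet_dual (A : Set G.Edge) :
    G.dual.rhoSet A = A.ncard + G.rhoSet Aᶜ - G.rhoSet Set.univ := by
  have h : (A.ncard : ℚ) + Aᶜ.ncard = Nat.card G.Edge := by
    exact_mod_cast Set.ncard_add_ncard_compl A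
  rw [rhoSet_univ, rhoSet_eq, rhoSet_eq, compl_compl, mixedOrbits_dual, ← h]
  -- The vertex orbits of the dual are by definition the boundary orbits of `G`.
  change ((Nat.card G.BoundaryOrbit : ℚ) + _ - _) / 2 = _
  ring

end RibbonGraph

/-! ### Exchange of the exponents and duality of the polynomial -/

namespace ColouredRibbonGraph

variable (G : ColouredRibbonGraph.{u})

/-- The vertex class graph of the dual is definitionally the boundary class graph of `G`. -/
theorem r1_dual (A : Set G.Edge) :
    G.dual.r1 Set.univ - G.dual.r1 A = G.r3 Aᶜ := by
  rw [r3, compl_compl]; rfl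

theorem r3_dual (A : Set G.Edge) :
    G.dual.r3 A = G.r1 Set.univ - G.r1 Aᶜ := rfl

/-- By `rhoSet_dual` the terms `|A|` cancel, leaving differences of `ρ` and of the rank in `G/𝒱`. -/
theorem r4_dual (A : Set G.Edge) :
    G.dual.r4 A = G.r2 Set.univ - G.r2 Aᶜ := by
  change (A.ncard : ℚ) + graphRank G.vertexClassGraph Aᶜ - graphRank G.vertexClassGraph Set.univ
    - G.toRibbonGraph.dual.rhoSet A = _
  rw [RibbonGraph.rhoSet_dual, r2, r2]
  ring

theorem r2_dual (A : Set G.Edge) :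
    G.dual.r2 Set.univ - G.dual.r2 A = G.r4 Aᶜ := by
  -- The double dual is definitionally `G`, so this is the previous identity read from the dual
  -- side.
  have h := G.dual.r4_dual Aᶜ
  rw [compl_compl] at h
  exact h.symm

theorem tutte_dual {σ : Type*} (w x y z : σ) : G.dual.tutte w x y z = G.tutte y z w x := by
  rw [tutte, tutte]
  -- The summand of the dual at `A` matches that of `G` at `Aᶜ`.
  refine (finsum_congr fun A => ?_).trans
    (finsum_comp_equiv (compl_involutive (α := Set G.Edge)).toPerm)
  rw [r1_dual, r2_dual, r3_dual, r4_dual]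
  change _ = power y (G.r1 Set.univ - G.r1 Aᶜ) * power z (G.r2 Set.univ - G.r2 Aᶜ) *
      power w (G.r3 Aᶜ) * power x (G.r4 Aᶜ)
  ring

end ColouredRibbonGraph

/-! ### Duality of edge types -/

theorem EdgeKind.swap_swap (k : EdgeKind) : k.swap.swap = k := by cases k <;> rfl

/-- The dual of a one-edge model is the model of the exchanged kind. -/
theorem EquivalentUpToIsolated.dual {G : ColouredRibbonGraph.{u}} {k : EdgeKind}
    (h : EquivalentUpToIsolated G k.model) : EquivalentUpToIsolated G.dual k.swap.model := by
  obtain ⟨φ, h0, h1, h2, hv, hb⟩ := h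
  -- A model corner records an end and a side of the edge; duality exchanges these, hence the swap
  -- of coordinates.
  refine ⟨φ.trans (Equiv.prodComm Bool Bool), fun c => ?_, fun c => ?_, fun c => ?_,
    fun c d => (hb c d).trans ?_, fun c d => (hv c d).trans ?_⟩
  · exact congrArg Prod.swap (h2 c)
  · refine (congrArg Prod.swap (h1 c)).trans ?_
    cases k <;> rfl
  · exact congrArg Prod.swap (h0 c)
  · cases k <;> exact Iff.rfl
  · cases k <;> exact Iff.rfl

/-- Deletion in the dual is dual to contraction, and contraction in the dual to deletion. -/
theorem ColouredRibbonGraph.HasType.dual {G : ColouredRibbonGraph.{u}} {e : G.Edge}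
    {i j : EdgeKind} (h : G.HasType e i j) : G.dual.HasType e j.swap i.swap :=
  -- `(G.delete D).dual` and `G.dual.contract D` agree definitionally, return maps and merged
  -- colours included; likewise with the operations exchanged.
  ⟨h.2.dual, h.1.dual⟩

theorem theorem3p9 {σ : Type*} (G : ColouredRibbonGraph.{u}) :
    (∀ w x y z : σ, G.dual.tutte w x y z = G.tutte y z w x) ∧
    (∀ (e : G.Edge) (i j : EdgeKind), G.HasType e i j ↔ G.dual.HasType e j.swap i.swap) := by
  refine ⟨G.tutte_dual, fun e i j => ⟨fun h => h.dual, fun h => ?_⟩⟩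
  -- The converse is the forward direction for `G.dual`, since the double dual is `G` and `swap` is
  -- an involution.
  have := h.dual
  rwa [EdgeKind.swap_swap, EdgeKind.swap_swap] at this
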